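/- Let $(R,\mathfrak m)$ and $(S,\mathfrak n)$ be Noetherian local rings with $R\subseteq S$ and $\mathfrak n\cap R=\mathfrak m$, complete with respect to the $\mathfrak m$-adic and the $\mathfrak n$-adic topology respectively. Assume that (i) $S$ is flat over $R$; (ii) the natural map of residue fields $R/\mathfrak m\to S/\mathfrak n$ is an isomorphism; (iii) the ideal $\mathfrak mS$ is prime in $S$. Then there are an integer $k\ge 0$ and elements $x_1,\dots,x_k\in\mathfrak n$ that are analytically independent over $R$, i.e. an $\mathfrak n$-adically convergent relation $\sum_{m\in\mathbb Z_{\ge 0}^k}a_m x_1^{m_1}\cdots x_k^{m_k}=0$ with all $a_m\in R$ holds only if all $a_m=0$, such that $\sum_m a_mX^m\mapsto\sum_m a_mx_1^{m_1}\cdots x_k^{m_k}$ (the sum being taken in the $\mathfrak n$-adic topology) defines an injective homomorphism of $R$-algebras $R[[X_1,\dots,X_k]]\to S$, with image denoted $R[[x_1,\dots,x_k]]$, so that $R\subseteq R[[x_1,\dots,x_k]]\subseteq S$, and $S$ is a finite module over $R[[x_1,\dots,x_k]]$. -/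

import Mathlib

open IsLocalRing

/-- For a local ring `S` that is an `R`-algebra, a family `x` of elements of `S`, and a formal power
series `f = ∑ a_m X^m` over `R`: the family `a_m x^m` of elements of `S` is summable, with sum `s`,
in the topology of `S` defined by the powers of its maximal ideal. -/
def PowerSeriesHasValue {R S : Type*} [CommRing R] [CommRing S] [IsLocalRing S] [Algebra R S]
    {k : ℕ} (x : Fin k → S) (f : MvPowerSeries (Fin k) R) (s : S) : Prop :=
  letI : TopologicalSpace S := (maximalIdeal S).adicTopology
  HasSum (fun m : Fin k →₀ ℕ => algebraMap R S (MvPowerSeries.coeff m f) * ∏ i, x i ^ m i) s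

/-- Elements `x_1, …, x_k` of the maximal ideal of the local ring `S` are analytically independent
over `R` if the only relation `∑ a_m x^m = 0` with coefficients `a_m` in `R` is the one with
all `a_m = 0`. -/
def AnalyticallyIndependent (R : Type*) {S : Type*} [CommRing R] [CommRing S] [IsLocalRing S]
    [Algebra R S] {k : ℕ} (x : Fin k → S) : Prop :=
  (∀ i, x i ∈ maximalIdeal S) ∧
    ∀ f : MvPowerSeries (Fin k) R, PowerSeriesHasValue x f 0 → f = 0

/-! Take the least k for which some x_1, …, x_k in 𝔫 make 𝔪S + (x) an ideal with radical 𝔫.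
Completeness of S gives the evaluation φ : R[[X]] → S at x.

Finiteness (`finite_of_powerSeriesHasValue`): for J = (𝔪, X), the ideal JS contains a power of 𝔫, so
S/JS is finite because the residue fields agree. Successive approximation lifts its generators to
generators of S.

Injectivity: suppose φ f ∈ 𝔪S while f has a unit coefficient. A suitable weight c singles out one
lowest term among those with unit coefficient. With t the last parameter and y_i = x_i - t^{c_i},
this term forces a power of t into 𝔪S + (y), so k - 1 elements suffice, against minimality
(`coeff_mem_maximalIdeal_of_value_mem`). Flatness then pushes the coefficients of a kernel element
into every 𝔪^n, and Krull's theorem makes them zero (`injective_of_flat_of_injective_mod`). Analytic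
independence follows since sums are unique. -/

namespace PowerSeriesHasValue

/-! ### Sums and evaluation of power series in the 𝔫-adic topology -/

variable {R S : Type*} [CommRing R] [CommRing S] [IsLocalRing S] [Algebra R S]
  {k : ℕ} {x : Fin k → S} {f : MvPowerSeries (Fin k) R} {s : S}

theorem exists_finset_sub_sum_mem (h : PowerSeriesHasValue x f s) (N : ℕ) :
    ∃ F₀ : Finset (Fin k →₀ ℕ), ∀ F, F₀ ⊆ F →
      s - ∑ m ∈ F, algebraMap R S (MvPowerSeries.coeff m f) * ∏ i, x i ^ m i
        ∈ maximalIdeal S ^ N := by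
  let : TopologicalSpace S := (maximalIdeal S).adicTopology
  have h' : HasSum (fun m : Fin k →₀ ℕ =>
    algebraMap R S (MvPowerSeries.coeff m f) * ∏ i, x i ^ m i) s := h
  have h1 := ((maximalIdeal S).hasBasis_nhds_adic s).tendsto_right_iff.mp h' N trivial
  obtain ⟨F₀, hF₀⟩ := Filter.eventually_atTop.mp h1
  refine ⟨F₀, fun F hF => ?_⟩
  obtain ⟨y, hy, hys⟩ := hF₀ F hF
  rw [← hys]
  simpa using hy

/-- Ideals of a Noetherian local ring are closed, hence contain the sums of series of
their elements. -/
theorem sub_term_mem [IsNoetherianRing S] (h : PowerSeriesHasValue x f s) (L : Ideal S)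
    (m₀ : Fin k →₀ ℕ)
    (hL : ∀ m, m ≠ m₀ → algebraMap R S (MvPowerSeries.coeff m f) * ∏ i, x i ^ m i ∈ L) :
    s - algebraMap R S (MvPowerSeries.coeff m₀ f) * ∏ i, x i ^ m₀ i ∈ L := by
  classical
  have key := (maximalIdeal S).iInf_pow_smul_eq_bot_of_isLocalRing (M := S ⧸ L)
    Ideal.IsPrime.ne_top'
  rw [← Ideal.Quotient.eq_zero_iff_mem, ← Submodule.mem_bot S, ← key, Submodule.mem_iInf]
  intro N
  obtain ⟨F₀, hF₀⟩ := h.exists_finset_sub_sum_mem N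
  have h1 := hF₀ (insert m₀ F₀) (Finset.subset_insert _ _)
  rw [← Finset.add_sum_erase _ _ (Finset.mem_insert_self m₀ F₀)] at h1
  have h2 : ∑ m ∈ (insert m₀ F₀).erase m₀,
      algebraMap R S (MvPowerSeries.coeff m f) * ∏ i, x i ^ m i ∈ L :=
    L.sum_mem fun m hm => hL m (Finset.ne_of_mem_erase hm)
  have h3 := Submodule.smul_mem_smul h1 (Submodule.mem_top (x := (1 : S ⧸ L)))
  convert h3 using 1
  rw [Algebra.smul_def, mul_one]
  refine Ideal.Quotient.eq.mpr ?_
  convert h2 using 1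
  ring

theorem mem [IsNoetherianRing S] (h : PowerSeriesHasValue x f s) (L : Ideal S)
    (hL : ∀ m, algebraMap R S (MvPowerSeries.coeff m f) * ∏ i, x i ^ m i ∈ L) : s ∈ L := by
  simpa using L.add_mem (h.sub_term_mem L 0 fun m _ => hL m) (hL 0)

theorem unique [IsNoetherianRing S] {t : S} (hs : PowerSeriesHasValue x f s)
    (ht : PowerSeriesHasValue x f t) : s = t := by
  classical
  have key := (maximalIdeal S).iInf_pow_eq_bot_of_isLocalRing Ideal.IsPrime.ne_top'
  rw [← sub_eq_zero, ← Ideal.mem_bot, ← key, Submodule.mem_iInf]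
  intro N
  obtain ⟨F₁, h₁⟩ := hs.exists_finset_sub_sum_mem N
  obtain ⟨F₂, h₂⟩ := ht.exists_finset_sub_sum_mem N
  have := Ideal.sub_mem _ (h₁ (F₁ ∪ F₂) Finset.subset_union_left)
    (h₂ (F₁ ∪ F₂) Finset.subset_union_right)
  simpa using this

theorem eq_of_X [IsNoetherianRing S] {i : Fin k}
    (h : PowerSeriesHasValue x (MvPowerSeries.X i : MvPowerSeries (Fin k) R) s) : s = x i := by
  classical
  have h1 := h.sub_term_mem ⊥ (Finsupp.single i 1) fun m hm => by
    simp [MvPowerSeries.coeff_X, hm]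
  rw [Ideal.mem_bot, sub_eq_zero] at h1
  rw [h1, Finset.prod_eq_single i (fun j _ hj => by simp [hj.symm]) (by simp)]
  simp [MvPowerSeries.coeff_X]

end PowerSeriesHasValue

/-- Power series over `R` can be evaluated at elements of the maximal ideal of a complete local
`R`-algebra. -/
theorem exists_algHom_powerSeriesHasValue {R S : Type*} [CommRing R] [CommRing S] [IsLocalRing S]
    [Algebra R S] [IsAdicComplete (maximalIdeal S) S] {k : ℕ} (x : Fin k → S)
    (hx : ∀ i, x i ∈ maximalIdeal S) :
    ∃ φ : MvPowerSeries (Fin k) R →ₐ[R] S, ∀ f, PowerSeriesHasValue x f (φ f) := by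
  let : WithIdeal S := ⟨maximalIdeal S⟩
  -- With `R` discrete, scalar multiplication is continuous for free; convergence comes from the `x
  -- i` being topologically nilpotent.
  let : UniformSpace R := ⊥
  have : DiscreteTopology R := ⟨rfl⟩
  have : IsUniformAddGroup R := inferInstance
  have had : IsAdic (maximalIdeal S) := rfl
  obtain ⟨_, _⟩ := had.isAdicComplete_iff.mp ‹_›
  have : IsLinearTopology S S := (maximalIdeal S).isLinearTopology
  have : ContinuousSMul R S := DiscreteTopology.instContinuousSMul R S
  have ha : MvPowerSeries.HasEval x := by
    refine ⟨fun i => WithIdeal.isTopologicallyNilpotent_of_mem (hx i), ?_⟩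
    rw [Filter.cofinite_eq_bot]
    exact Filter.tendsto_bot
  refine ⟨MvPowerSeries.aeval ha, fun f => ?_⟩
  have h := MvPowerSeries.hasSum_aeval (R := R) ha f
  simp only [Algebra.smul_def] at h
  have h2 : ∀ m : Fin k →₀ ℕ, (m.prod fun s e => x s ^ e) = ∏ i, x i ^ m i := fun m =>
    Finsupp.prod_fintype _ _ (by simp)
  simp only [h2] at h
  exact h

/-! ### Filtration of R[[X]] by total degree -/

namespace MvPowerSeries

variable {σ R : Type*} [CommRing R]

/-- The power series whose coefficient at `X^d` lies in `I ^ (n - |d|)` for all `d`. -/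
def totalFiltration (σ : Type*) (I : Ideal R) (n : ℕ) : Ideal (MvPowerSeries σ R) where
  carrier := {f | ∀ d, coeff d f ∈ I ^ (n - d.degree)}
  add_mem' hf hg d := by simpa using Ideal.add_mem _ (hf d) (hg d)
  zero_mem' d := by simp
  smul_mem' c f hf d := by
    classical
    rw [smul_eq_mul, coeff_mul]
    refine Ideal.sum_mem _ fun p hp => Ideal.mul_mem_left _ _ ?_
    refine Ideal.pow_le_pow_right ?_ (hf p.2)
    have : p.1.degree + p.2.degree = d.degree := by
      rw [← map_add, Finset.HasAntidiagonal.mem_antidiagonal.mp hp]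
    omega

theorem totalFiltration_mul_le (I : Ideal R) (a b : ℕ) :
    totalFiltration σ I a * totalFiltration σ I b ≤ totalFiltration σ I (a + b) := by
  classical
  refine Ideal.mul_le.mpr fun f hf g hg d => ?_
  rw [coeff_mul]
  refine Ideal.sum_mem _ fun p hp => ?_
  have : p.1.degree + p.2.degree = d.degree := by
    rw [← map_add, Finset.HasAntidiagonal.mem_antidiagonal.mp hp]
  refine Ideal.pow_le_pow_right (show _ ≤ (a - p.1.degree) + (b - p.2.degree) by omega) ?_
  rw [pow_add]
  exact Ideal.mul_mem_mul (hf p.1) (hg p.2)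

theorem map_C_sup_span_X_pow_le (I : Ideal R) (n : ℕ) :
    (I.map (C (σ := σ)) ⊔ Ideal.span (Set.range X)) ^ n ≤ totalFiltration σ I n := by
  classical
  induction n with
  | zero => intro f _ d; simp
  | succ n ih =>
    rw [pow_succ]
    refine (Ideal.mul_mono ih (sup_le ?_ ?_)).trans (totalFiltration_mul_le I n 1)
    · refine Ideal.map_le_iff_le_comap.mpr fun a ha d => ?_
      rw [coeff_C]
      split_ifs with h
      · simpa [h] using ha
      · exact zero_mem _
    · rw [Ideal.span_le]
      rintro _ ⟨i, rfl⟩ d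
      rw [coeff_X]
      split_ifs with h
      · simp [h]
      · exact zero_mem _

/-- Series of power series converge in the filtration by total degree. -/
theorem exists_sub_sum_mem_totalFiltration (I : Ideal R) [IsPrecomplete I R]
    (g : ℕ → MvPowerSeries σ R) (hg : ∀ n, g n ∈ totalFiltration σ I n) :
    ∃ f, ∀ N, f - ∑ n ∈ Finset.range N, g n ∈ totalFiltration σ I N := by
  have key : ∀ d : σ →₀ ℕ, ∃ L : R, ∀ N,
      L - coeff d (∑ n ∈ Finset.range N, g n) ∈ I ^ (N - d.degree) := by
    intro d
    -- Shifting the index by |d| makes the coefficients at d an I-adic Cauchy sequence in the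
    -- indexing that `IsPrecomplete` demands.
    obtain ⟨L, hL⟩ := IsPrecomplete.prec ‹IsPrecomplete I R›
      (f := fun N => coeff d (∑ n ∈ Finset.range (N + d.degree), g n)) (by
        intro a b hab
        rw [SModEq.sub_mem, smul_eq_mul, Ideal.mul_top, ← neg_mem_iff, neg_sub, ← map_sub,
          ← Finset.sum_Ico_eq_sub _ (by omega), map_sum]
        refine Ideal.sum_mem _ fun n hn => Ideal.pow_le_pow_right ?_ (hg n d)
        have := Finset.mem_Ico.mp hn
        omega)
    refine ⟨L, fun N => ?_⟩
    rcases le_total d.degree N with h | h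
    · have := hL (N - d.degree)
      rw [SModEq.sub_mem, smul_eq_mul, Ideal.mul_top, ← neg_mem_iff, neg_sub] at this
      simpa [Nat.sub_add_cancel h] using this
    · simp [Nat.sub_eq_zero_of_le h]
  choose f hf using key
  let F : MvPowerSeries σ R := f
  have hF : ∀ d, coeff d F = f d := fun _ => rfl
  exact ⟨F, fun N d => by rw [map_sub, hF]; exact hf d N⟩

end MvPowerSeries

/-! ### Finiteness of S over R[[X]] -/

/-- One step of successive approximation: multiply M = ⟨b⟩ + JM by J^n. -/
theorem Submodule.exists_sub_sum_mem_pow_smul_top {A M ι : Type*} [CommRing A] [AddCommGroup M]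
    [Module A M] [Fintype ι] {J : Ideal A} {b : ι → M}
    (hb : span A (Set.range b) ⊔ J • (⊤ : Submodule A M) = ⊤) (n : ℕ) {s : M}
    (hs : s ∈ J ^ n • (⊤ : Submodule A M)) :
    ∃ g : ι → A, (∀ j, g j ∈ J ^ n) ∧
      s - ∑ j, g j • b j ∈ J ^ (n + 1) • (⊤ : Submodule A M) := by
  rw [← hb, smul_sup, ← smul_assoc, smul_eq_mul, ← pow_succ, mem_sup] at hs
  obtain ⟨u, hu, v, hv, rfl⟩ := hs
  obtain ⟨a, ha, rfl⟩ := (mem_ideal_smul_span_iff_exists_sum (J ^ n) b u).mp hu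
  refine ⟨a, ha, ?_⟩
  rw [Finsupp.sum_fintype _ _ (by simp), add_sub_cancel_left]
  exact hv

/-- Modulo a power of its maximal ideal, a Noetherian local ring is finite over any local ring with
the same residue field. -/
theorem IsLocalRing.exists_fg_sup_pow_eq_top {R S : Type*} [CommRing R] [CommRing S]
    [IsLocalRing R] [IsLocalRing S] [Algebra R S] [IsLocalHom (algebraMap R S)]
    [IsNoetherianRing S] (hres : Function.Surjective (ResidueField.map (algebraMap R S))) (n : ℕ) :
    ∃ N : Submodule R S, N.FG ∧ N ⊔ (maximalIdeal S ^ n).restrictScalars R = ⊤ := by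
  have hlift : ∀ s : S, ∃ r : R, s - algebraMap R S r ∈ maximalIdeal S := by
    intro s
    obtain ⟨a, ha⟩ := hres (residue S s)
    obtain ⟨r, rfl⟩ := residue_surjective a
    refine ⟨r, Ideal.Quotient.eq.mp ?_⟩
    rw [ResidueField.map_residue] at ha
    exact ha.symm
  induction n with
  | zero => exact ⟨⊥, Submodule.fg_bot, by simp [Ideal.one_eq_top]⟩
  | succ n ih =>
    obtain ⟨N, hN, hNtop⟩ := ih
    obtain ⟨G, hG⟩ := (isNoetherianRing_iff_ideal_fg S).mp ‹_› (maximalIdeal S ^ n)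
    refine ⟨N ⊔ Submodule.span R G, hN.sup (Submodule.fg_span G.finite_toSet), ?_⟩
    rw [eq_top_iff, ← hNtop, sup_assoc]
    refine sup_le_sup_left ?_ _
    intro s hs
    have hs : s ∈ Submodule.span S (G : Set S) := by
      rw [show Submodule.span S (G : Set S) = maximalIdeal S ^ n from hG]; exact hs
    induction hs using Submodule.span_induction with
    | mem y hy => exact Submodule.mem_sup_left (Submodule.subset_span hy)
    | zero => exact zero_mem _
    | add y z hy hz h1 h2 =>
      rw [← hG] at *
      exact add_mem (h1 hy) (h2 hz)
    | smul c y hy h1 =>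
      have hy' : y ∈ maximalIdeal S ^ n := by rw [← hG]; exact hy
      obtain ⟨r, hr⟩ := hlift c
      -- Replacing c by a representative r of its residue class costs only an element of 𝔫^(n+1).
      have : c • y = r • y + (c - algebraMap R S r) * y := by
        rw [Algebra.smul_def r, smul_eq_mul]; ring
      rw [this]
      refine add_mem (Submodule.smul_mem _ r (h1 hy')) (Submodule.mem_sup_right ?_)
      rw [Submodule.restrictScalars_mem, pow_succ']
      exact Ideal.mul_mem_mul hr hy'

/-- A complete local algebra `S` is finite over `R[[x₁, …, x_k]]` as soon as `x₁, …, x_k` generate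
an ideal of definition modulo the maximal ideal of `R`. -/
theorem finite_of_powerSeriesHasValue {R S : Type*} [CommRing R] [CommRing S]
    [IsLocalRing R] [IsLocalRing S] [Algebra R S] [IsLocalHom (algebraMap R S)]
    [IsNoetherianRing S] [IsAdicComplete (maximalIdeal R) R] [IsAdicComplete (maximalIdeal S) S]
    (hres : Function.Surjective (ResidueField.map (algebraMap R S))) {k : ℕ} {x : Fin k → S}
    (hx : ∀ i, x i ∈ maximalIdeal S)
    (hrad : maximalIdeal S ≤
      ((maximalIdeal R).map (algebraMap R S) ⊔ Ideal.span (Set.range x)).radical)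
    (φ : MvPowerSeries (Fin k) R →ₐ[R] S) (hφ : ∀ f, PowerSeriesHasValue x f (φ f)) :
    φ.Finite := by
  let A := MvPowerSeries (Fin k) R
  let J : Ideal A := (maximalIdeal R).map (MvPowerSeries.C (σ := Fin k)) ⊔
    Ideal.span (Set.range MvPowerSeries.X)
  have hJφ : J.map φ.toRingHom =
      (maximalIdeal R).map (algebraMap R S) ⊔ Ideal.span (Set.range x) := by
    have hC : φ.toRingHom.comp (MvPowerSeries.C (σ := Fin k)) = algebraMap R S :=
      RingHom.ext fun r => φ.commutes r
    have hX : (fun i => φ (MvPowerSeries.X i)) = x := funext fun i => (hφ _).eq_of_X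
    rw [Ideal.map_sup, Ideal.map_map, hC, Ideal.map_span, ← Set.range_comp, ← hX]
    rfl
  have hmn : (maximalIdeal R).map (algebraMap R S) ≤ maximalIdeal S :=
    ((local_hom_TFAE (algebraMap R S)).out 0 2).mp ‹_›
  have hJn : J.map φ.toRingHom ≤ maximalIdeal S := by
    rw [hJφ]
    exact sup_le hmn (Ideal.span_le.mpr (by rintro _ ⟨i, rfl⟩; exact hx i))
  obtain ⟨N, hN⟩ := Ideal.exists_pow_le_of_le_radical_of_fg (hJφ ▸ hrad)
    ((isNoetherianRing_iff_ideal_fg S).mp ‹_› (maximalIdeal S))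
  obtain ⟨W, ⟨b, hb⟩, hW⟩ := IsLocalRing.exists_fg_sup_pow_eq_top hres N
  algebraize [φ.toRingHom]
  have hsmul : ∀ (I : Ideal A) (t : S),
      t ∈ I • (⊤ : Submodule A S) ↔ t ∈ I.map φ.toRingHom := by
    intro I t
    rw [Ideal.smul_top_eq_map]
    rfl
  have htop : Submodule.span A (Set.range ((↑) : b → S)) ⊔ J • (⊤ : Submodule A S) = ⊤ := by
    rw [eq_top_iff]
    intro s _
    have hs : s ∈ W ⊔ (maximalIdeal S ^ N).restrictScalars R := hW ▸ Submodule.mem_top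
    obtain ⟨u, hu, v, hv, rfl⟩ := Submodule.mem_sup.mp hs
    refine add_mem (Submodule.mem_sup_left ?_) (Submodule.mem_sup_right ?_)
    · rw [← hb] at hu
      have : IsScalarTower R A S := IsScalarTower.of_algebraMap_eq fun r => (φ.commutes r).symm
      simpa using Submodule.span_le_restrictScalars R A _ hu
    · exact (hsmul J v).mpr (hN hv)
  refine RingHom.finite_algebraMap.mpr ⟨⟨b, ?_⟩⟩
  rw [eq_top_iff]
  intro s _
  choose! G hGJ hGs using fun (n : ℕ) (t : S) (ht : t ∈ J ^ n • (⊤ : Submodule A S)) =>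
    Submodule.exists_sub_sum_mem_pow_smul_top htop n ht
  -- The remainder of s after n corrections.
  let t : ℕ → S := fun n => Nat.rec s (fun n t => t - ∑ j, G n t j • (j : S)) n
  have ht_succ : ∀ n, t (n + 1) = t n - ∑ j, G n (t n) j • (j : S) := fun n => rfl
  have ht : ∀ n, t n ∈ J ^ n • (⊤ : Submodule A S) := by
    intro n
    induction n with
    | zero => rw [pow_zero, one_smul]; exact Submodule.mem_top
    | succ n ih => exact hGs n _ ih
  choose F hF using fun j : b =>
    MvPowerSeries.exists_sub_sum_mem_totalFiltration (maximalIdeal R) (fun n => G n (t n) j)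
      fun n => MvPowerSeries.map_C_sup_span_X_pow_le _ n (hGJ n _ (ht n) j)
  have hval : ∀ (n : ℕ) (f : A), f ∈ MvPowerSeries.totalFiltration (Fin k) (maximalIdeal R) n →
      φ f ∈ maximalIdeal S ^ n := by
    intro n f hf
    refine (hφ f).mem _ fun m => ?_
    refine Ideal.pow_le_pow_right (show n ≤ (n - m.degree) + m.degree by omega) ?_
    rw [pow_add]
    refine Ideal.mul_mem_mul ?_ ?_
    · refine Ideal.pow_right_mono hmn _ ?_
      rw [← Ideal.map_pow]
      exact Ideal.mem_map_of_mem _ (hf m)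
    · rw [Finsupp.degree_eq_sum, ← Finset.prod_pow_eq_pow_sum]
      exact Ideal.prod_mem_prod fun i _ => Ideal.pow_mem_pow (hx i) _
  have hts : ∀ n, s = t n + ∑ j : b, φ (∑ l ∈ Finset.range n, G l (t l) j) * (j : S) := by
    intro n
    induction n with
    | zero => simp [t]
    | succ n ih =>
      simp only [Finset.sum_range_succ, map_add, add_mul, Finset.sum_add_distrib]
      rw [ht_succ, show ∑ j : b, G n (t n) j • (j : S) = ∑ j : b, φ (G n (t n) j) * (j : S) from
        rfl]
      refine ih.trans ?_
      ring
  have hs : s = ∑ j : b, F j • (j : S) := by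
    have key := (maximalIdeal S).iInf_pow_eq_bot_of_isLocalRing Ideal.IsPrime.ne_top'
    rw [← sub_eq_zero, ← Ideal.mem_bot, ← key, Submodule.mem_iInf]
    intro n
    have h1 : s - ∑ j : b, F j • (j : S) =
        t n - ∑ j : b, φ (F j - ∑ l ∈ Finset.range n, G l (t l) j) * (j : S) := by
      rw [show ∑ j : b, F j • (j : S) = ∑ j : b, φ (F j) * (j : S) from rfl]
      simp only [map_sub, sub_mul, Finset.sum_sub_distrib]
      linear_combination hts n
    rw [h1]
    refine sub_mem ?_ (Ideal.sum_mem _ fun j _ => Ideal.mul_mem_right _ _ (hval n _ (hF j n)))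
    have := (hsmul _ _).mp (ht n)
    rw [Ideal.map_pow] at this
    exact Ideal.pow_right_mono hJn n this
  rw [hs]
  exact Submodule.sum_mem _ fun j _ => Submodule.smul_mem _ _ (Submodule.subset_span j.2)

/-! ### Injectivity modulo 𝔪 -/

/-- Some positive linear form with last coefficient `1` has a strict minimum on a given nonempty
set of exponents. -/
theorem exists_weight_strict_min {n : ℕ} (T : Set (Fin (n + 1) → ℕ)) (hT : T.Nonempty) :
    ∃ m ∈ T, ∃ c : Fin (n + 1) → ℕ, c (Fin.last n) = 1 ∧ (∀ i, 0 < c i) ∧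
      ∀ m' ∈ T, m' ≠ m → ∑ i, c i * m i < ∑ i, c i * m' i := by
  classical
  induction n with
  | zero =>
    obtain ⟨m, hm, hmin⟩ := WellFounded.has_min
      (InvImage.wf (fun m : Fin 1 → ℕ => m 0) wellFounded_lt) T hT
    refine ⟨m, hm, fun _ => 1, rfl, fun _ => one_pos, fun m' hm' hne => ?_⟩
    have h1 : m 0 ≤ m' 0 := not_lt.mp (hmin m' hm')
    have h2 : m' 0 ≠ m 0 := fun h => hne (funext fun i => by rw [show i = 0 from Subsingleton.elim (α := Fin 1) i 0, h])
    simpa using lt_of_le_of_ne h1 h2.symm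
  | succ n ih =>
    obtain ⟨p, hp, hmin⟩ := WellFounded.has_min
      (InvImage.wf (fun m : Fin (n + 2) → ℕ => m 0) wellFounded_lt) T hT
    obtain ⟨q, hq, c, hc, hpos, hlt⟩ := ih {q | Fin.cons (p 0) q ∈ T}
      ⟨Fin.tail p, by simpa using hp⟩
    -- The first weight exceeds the weighted sum of the tail q, so any exponent with larger first
    -- entry loses whatever its tail; ties are settled by induction.
    refine ⟨Fin.cons (p 0) q, hq, Fin.cons (1 + ∑ i, c i * q i) c, ?_, ?_, ?_⟩
    · rw [← Fin.succ_last, Fin.cons_succ, hc]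
    · exact Fin.cases (by simp) fun i => by simpa using hpos i
    · intro m' hm' hne
      have h1 : p 0 ≤ m' 0 := not_lt.mp (hmin m' hm')
      rw [Fin.sum_univ_succ, Fin.sum_univ_succ (n := n + 1)]
      simp only [Fin.cons_zero, Fin.cons_succ]
      rcases h1.eq_or_lt with h | h
      · have := hlt (Fin.tail m') (by simpa [h] using hm')
          (fun h' => hne (by rw [← h', h, Fin.cons_self_tail]))
        rw [h]
        exact Nat.add_lt_add_left this _
      · calc (1 + ∑ i, c i * q i) * p 0 + ∑ i, c i * q i
            < (1 + ∑ i, c i * q i) * p 0 + (1 + ∑ i, c i * q i) := by omega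
          _ = (1 + ∑ i, c i * q i) * (p 0 + 1) := by ring
          _ ≤ (1 + ∑ i, c i * q i) * m' 0 := Nat.mul_le_mul_left _ h
          _ ≤ _ := Nat.le_add_right _ _

/-- If the number of parameters is minimal, a power series whose value vanishes modulo the maximal
ideal of `R` vanishes modulo that ideal. -/
theorem coeff_mem_maximalIdeal_of_value_mem {R S : Type*} [CommRing R] [CommRing S]
    [IsLocalRing R] [IsLocalRing S] [Algebra R S] [IsLocalHom (algebraMap R S)]
    [IsNoetherianRing S] {k : ℕ} {x : Fin k → S} (hx : ∀ i, x i ∈ maximalIdeal S)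
    (hrad : maximalIdeal S ≤
      ((maximalIdeal R).map (algebraMap R S) ⊔ Ideal.span (Set.range x)).radical)
    (hmin : ∀ l < k, ∀ y : Fin l → S, (∀ i, y i ∈ maximalIdeal S) → ¬ maximalIdeal S ≤
      ((maximalIdeal R).map (algebraMap R S) ⊔ Ideal.span (Set.range y)).radical)
    {f : MvPowerSeries (Fin k) R} {s : S} (hf : PowerSeriesHasValue x f s)
    (hs : s ∈ (maximalIdeal R).map (algebraMap R S)) (d : Fin k →₀ ℕ) :
    MvPowerSeries.coeff d f ∈ maximalIdeal R := by
  have hmn : (maximalIdeal R).map (algebraMap R S) ≤ maximalIdeal S :=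
    ((local_hom_TFAE (algebraMap R S)).out 0 2).mp ‹_›
  by_contra hd
  rcases k with _ | n
  · have h := hf.sub_term_mem ⊥ d fun m hm => absurd (Subsingleton.elim m d) hm
    rw [Ideal.mem_bot, sub_eq_zero] at h
    rw [h] at hs
    simp only [Finset.univ_eq_empty, Finset.prod_empty, mul_one] at hs
    exact (mem_maximalIdeal _).mp (hmn hs)
      ((by simpa using hd : IsUnit (MvPowerSeries.coeff d f)).map _)
  obtain ⟨m, hm, c, hc, hpos, hlt⟩ := exists_weight_strict_min
    ((fun m : Fin (n + 1) →₀ ℕ => (m : Fin (n + 1) → ℕ)) ''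
      {m | MvPowerSeries.coeff m f ∉ maximalIdeal R}) ⟨_, d, hd, rfl⟩
  obtain ⟨m, hm, rfl⟩ := hm
  let t := x (Fin.last n)
  -- Since the last weight is 1, the last difference would be t - t = 0, so n elements remain and
  -- x_i ≡ t^{c_i} modulo K for every i.
  let y : Fin n → S := fun i => x i.castSucc - t ^ (c i.castSucc)
  let K : Ideal S := (maximalIdeal R).map (algebraMap R S) ⊔ Ideal.span (Set.range y)
  have hxt : ∀ i, Ideal.Quotient.mk K (x i) = Ideal.Quotient.mk K (t ^ c i) := by
    intro i
    refine Fin.lastCases ?_ (fun i => ?_) i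
    · rw [hc, pow_one]
    · exact Ideal.Quotient.eq.mpr (Ideal.mem_sup_right (Ideal.subset_span ⟨i, rfl⟩))
  have hmon : ∀ p : Fin (n + 1) →₀ ℕ, ∏ i, x i ^ p i - t ^ ∑ i, c i * p i ∈ K := by
    intro p
    rw [← Ideal.Quotient.eq, map_prod]
    simp only [map_pow, hxt, ← Finset.prod_pow_eq_pow_sum, map_prod, pow_mul]
  set w := ∑ i, c i * m i with hw
  have hterm : ∀ p, p ≠ m → algebraMap R S (MvPowerSeries.coeff p f) * ∏ i, x i ^ p i ∈
      K ⊔ Ideal.span {t ^ (w + 1)} := by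
    intro p hp
    by_cases hpc : MvPowerSeries.coeff p f ∈ maximalIdeal R
    · exact Ideal.mem_sup_left (Ideal.mem_sup_left
        (Ideal.mul_mem_right _ _ (Ideal.mem_map_of_mem _ hpc)))
    · have h1 : w < ∑ i, c i * p i := hlt p ⟨p, hpc, rfl⟩ (by simpa using hp)
      refine Ideal.mul_mem_left _ _ ?_
      rw [← sub_add_cancel (∏ i, x i ^ p i) (t ^ ∑ i, c i * p i)]
      exact add_mem (Ideal.mem_sup_left (hmon p)) (Ideal.mem_sup_right
        (Ideal.mem_span_singleton.mpr (pow_dvd_pow t h1)))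
  have h2 : algebraMap R S (MvPowerSeries.coeff m f) * ∏ i, x i ^ m i ∈
      K ⊔ Ideal.span {t ^ (w + 1)} := by
    have := sub_mem (Ideal.mem_sup_left (Ideal.mem_sup_left hs)) (hf.sub_term_mem _ m hterm)
    rwa [sub_sub_cancel] at this
  have hu : IsUnit (algebraMap R S (MvPowerSeries.coeff m f)) :=
    (by simpa using hm : IsUnit (MvPowerSeries.coeff m f)).map _
  have h3 : t ^ w ∈ K ⊔ Ideal.span {t ^ (w + 1)} := by
    have := sub_mem ((Ideal.unit_mul_mem_iff_mem _ hu).mp h2) (Ideal.mem_sup_left (hmon m))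
    rwa [sub_sub_cancel] at this
  have h4 : t ^ w ∈ K := by
    -- From t^w = a + z t^(w+1) with a ∈ K, cancel the unit 1 - zt.
    obtain ⟨a, ha, b, hb, hab⟩ := Submodule.mem_sup.mp h3
    obtain ⟨z, rfl⟩ := Ideal.mem_span_singleton'.mp hb
    have hunit : IsUnit (1 - z * t) := by
      by_contra hnu
      have : (1 : S) ∈ maximalIdeal S := by
        have := add_mem ((mem_maximalIdeal _).mpr hnu)
          ((maximalIdeal S).mul_mem_left z (hx (Fin.last n)))
        rwa [sub_add_cancel] at this
      exact (mem_maximalIdeal _).mp this isUnit_one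
    refine (Ideal.unit_mul_mem_iff_mem _ hunit).mp ?_
    convert ha using 1
    linear_combination -hab
  have h5 : t ∈ K.radical := ⟨w, h4⟩
  have hy : ∀ i, y i ∈ maximalIdeal S := fun i =>
    sub_mem (hx _) (Ideal.pow_mem_of_mem _ (hx _) _ (hpos _))
  refine hmin n (Nat.lt_succ_self n) y hy (hrad.trans (Ideal.radical_le_radical_iff.mpr ?_))
  refine sup_le (le_sup_left.trans Ideal.le_radical) (Ideal.span_le.mpr ?_)
  rintro _ ⟨i, rfl⟩
  have := add_mem (Ideal.le_radical (Ideal.Quotient.eq.mp (hxt i)))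
    (Ideal.pow_mem_of_mem _ h5 _ (hpos i))
  rwa [sub_add_cancel] at this

/-! ### Injectivity through flatness -/

/-- The coefficients in a linear relation between minimal generators lie in the maximal ideal. -/
theorem IsLocalRing.exists_generators_relation_mem {R M : Type*} [CommRing R] [IsLocalRing R]
    [AddCommGroup M] [Module R M] {N : Submodule R M} (hN : N.FG) :
    ∃ (r : ℕ) (e : Fin r → M), Submodule.span R (Set.range e) = N ∧
      ∀ a : Fin r → R, ∑ j, a j • e j = 0 → ∀ j, a j ∈ maximalIdeal R := by
  classical
  have hex : ∃ (r : ℕ) (e : Fin r → M), Submodule.span R (Set.range e) = N :=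
    Submodule.fg_iff_exists_fin_generating_family.mp hN
  obtain ⟨e, he⟩ := Nat.find_spec hex
  refine ⟨Nat.find hex, e, he, fun a ha j => ?_⟩
  by_contra hj
  have hu : IsUnit (a j) := by simpa using hj
  obtain ⟨n, hn⟩ : ∃ n, Nat.find hex = n + 1 :=
    Nat.exists_eq_succ_of_ne_zero (Nat.ne_of_gt j.pos)
  revert e a j
  rw [hn]
  intro e he a ha j _ hu
  refine Nat.find_min hex (show n < Nat.find hex by omega) ⟨e ∘ j.succAbove, ?_⟩
  rw [← he]
  refine le_antisymm (Submodule.span_mono (Set.range_comp_subset_range _ _))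
    (Submodule.span_le.mpr ?_)
  rintro _ ⟨i, rfl⟩
  refine Fin.succAboveCases j ?_ (fun i => Submodule.subset_span ⟨i, rfl⟩) i
  rw [Fin.sum_univ_succAbove _ j] at ha
  refine (Submodule.smul_mem_iff_of_isUnit _ hu).mp ?_
  rw [eq_neg_of_add_eq_zero_left ha]
  exact neg_mem (Submodule.sum_mem _ fun i _ =>
    Submodule.smul_mem _ _ (Submodule.subset_span ⟨i, rfl⟩))

/-- If the algebra homomorphism `φ : R[[X]] → S` to a flat algebra is injective modulo the maximal
ideal of `R`, then it is injective. -/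
theorem injective_of_flat_of_injective_mod {σ R S : Type*} [CommRing R] [CommRing S]
    [IsLocalRing R] [Algebra R S] [IsNoetherianRing R] [Module.Flat R S]
    (φ : MvPowerSeries σ R →ₐ[R] S)
    (hφ : ∀ f, φ f ∈ (maximalIdeal R).map (algebraMap R S) →
      ∀ d, MvPowerSeries.coeff d f ∈ maximalIdeal R) :
    Function.Injective φ := by
  rw [injective_iff_map_eq_zero]
  intro f hf
  have key : ∀ n d, MvPowerSeries.coeff d f ∈ maximalIdeal R ^ n := by
    intro n
    induction n with
    | zero => simp
    | succ n ih =>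
      obtain ⟨r, e, he, hrel⟩ := IsLocalRing.exists_generators_relation_mem
        ((isNoetherianRing_iff_ideal_fg R).mp ‹_› (maximalIdeal R ^ n))
      have hex : ∀ d, ∃ c : Fin r → R, ∑ j, c j • e j = MvPowerSeries.coeff d f := fun d =>
        (Submodule.mem_span_range_iff_exists_fun R).mp (he ▸ ih d)
      choose c hc using hex
      let g : Fin r → MvPowerSeries σ R := fun j d => c d j
      have hg : ∀ j d, MvPowerSeries.coeff d (g j) = c d j := fun _ _ => rfl
      have hfg : f = ∑ j, e j • g j := by
        ext d
        rw [← hc d, map_sum]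
        exact Finset.sum_congr rfl fun j _ => by
          rw [map_smul, hg, smul_eq_mul, smul_eq_mul, mul_comm]
      have h0 : ∑ j, e j • φ (g j) = 0 := by
        rw [← hf, hfg, map_sum]
        exact Finset.sum_congr rfl fun j _ => (map_smul φ _ _).symm
      -- Equational criterion: φ(g_j) = ∑ a_ji y_i with ∑_j a_ji e_j = 0, and minimality of the e_j
      -- puts every a_ji in 𝔪.
      obtain ⟨l, a, y, hy, ha⟩ :=
        Module.Flat.isTrivialRelation_of_sum_smul_eq_zero (R := R) (M := S) h0
      have hmem : ∀ j, φ (g j) ∈ (maximalIdeal R).map (algebraMap R S) := by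
        intro j
        rw [show φ (g j) = _ from hy j]
        refine Ideal.sum_mem _ fun i _ => ?_
        rw [Algebra.smul_def]
        refine Ideal.mul_mem_right _ _ (Ideal.mem_map_of_mem _ (hrel (fun j => a j i) ?_ j))
        rw [← ha i]
        exact Finset.sum_congr rfl fun j _ => mul_comm _ _
      intro d
      rw [← hc d, pow_succ']
      refine Ideal.sum_mem _ fun j _ => Ideal.mul_mem_mul (hφ _ (hmem j) d) ?_
      rw [← he]
      exact Submodule.subset_span ⟨j, rfl⟩
  ext d
  have h := (maximalIdeal R).iInf_pow_eq_bot_of_isLocalRing Ideal.IsPrime.ne_top'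
  rw [map_zero, ← Ideal.mem_bot, ← h, Submodule.mem_iInf]
  exact fun n => key n d

/-! ### The theorem -/

theorem theoremT {R S : Type*} [CommRing R] [CommRing S] [IsLocalRing R] [IsLocalRing S]
    [Algebra R S]
    -- `R ⊆ S`, and the maximal ideal of `S` lies over that of `R`
    (hinj : Function.Injective (algebraMap R S)) [IsLocalHom (algebraMap R S)]
    [IsNoetherianRing R] [IsNoetherianRing S]
    [IsAdicComplete (maximalIdeal R) R] [IsAdicComplete (maximalIdeal S) S]
    (hflat : Module.Flat R S)
    (hres : Function.Bijective (ResidueField.map (algebraMap R S)))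
    (hfib : ((maximalIdeal R).map (algebraMap R S)).IsPrime) :
    ∃ (k : ℕ) (x : Fin k → S),
      AnalyticallyIndependent R x ∧
      -- evaluation at `x` is an embedding of `R`-algebras `R[[X_1, …, X_k]] → S`, and `S` is
      -- a finite module over its image `R[[x_1, …, x_k]]`
      ∃ φ : MvPowerSeries (Fin k) R →ₐ[R] S,
        (∀ f, PowerSeriesHasValue x f (φ f)) ∧ Function.Injective φ ∧ φ.Finite := by
  classical
  have hex : ∃ (k : ℕ) (x : Fin k → S), (∀ i, x i ∈ maximalIdeal S) ∧ maximalIdeal S ≤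
      ((maximalIdeal R).map (algebraMap R S) ⊔ Ideal.span (Set.range x)).radical := by
    obtain ⟨k, x, hx⟩ := Submodule.fg_iff_exists_fin_generating_family.mp
      ((isNoetherianRing_iff_ideal_fg S).mp ‹_› (maximalIdeal S))
    exact ⟨k, x, fun i => hx ▸ Submodule.subset_span ⟨i, rfl⟩,
      hx.ge.trans (le_sup_right.trans Ideal.le_radical)⟩
  obtain ⟨x, hx, hrad⟩ := Nat.find_spec hex
  have hmin : ∀ l < Nat.find hex, ∀ y : Fin l → S, (∀ i, y i ∈ maximalIdeal S) →
      ¬ maximalIdeal S ≤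
        ((maximalIdeal R).map (algebraMap R S) ⊔ Ideal.span (Set.range y)).radical :=
    fun l hl y hy h => Nat.find_min hex hl ⟨y, hy, h⟩
  obtain ⟨φ, hφ⟩ := exists_algHom_powerSeriesHasValue (R := R) x hx
  have hφinj : Function.Injective φ := injective_of_flat_of_injective_mod φ fun f hf =>
    coeff_mem_maximalIdeal_of_value_mem hx hrad hmin (hφ f) hf
  refine ⟨_, x, ⟨hx, fun f hf => hφinj ?_⟩, φ, hφ, hφinj,
    finite_of_powerSeriesHasValue hres.surjective hx hrad φ hφ⟩
  rw [map_zero]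
  exact (hφ f).unique hf
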